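/- **Model.** Let $X,U,AP,Q$ be finite, $X\neq\emptyset$. Each $x\in X$ has a nonempty set $U(x)\subseteq U$ of allowed actions, costs $c_D(x,u)>0$ for $u\in U(x)$, and a set $L(x)\subseteq 2^{AP}$ of possible labels. The transition probabilities $p_D(x,u,\cdot)$ and label probabilities $p_L(x,\cdot)$ are unknown; under the belief $\boldsymbol\alpha$ they are independent, $p_D(x,u,\cdot)\sim\mathrm{Dirichlet}(\alpha^u_x)$ and $p_L(x,\cdot)\sim\mathrm{Dirichlet}(\alpha^L_x)$, with nonnegative parameters, not all zero for each $x$ and $u\in U(x)$, and $\alpha^L_x(l)=0$ for $l\notin L(x)$ (coordinates with zero parameter are $0$ almost surely). A sample $\mathcal M$ is an MDP on pairs $(x,l)$. Let $\mathcal A$ be a deterministic Rabin automaton with states $Q$, transition function $\delta$ and pairs $(H^i,I^i)$. The product $\mathcal P=\mathcal M\times\mathcal A$ has states $S=\{(x,l,q): l\in L(x)\}$, actions $U(s)=U(x)$, $E=\{(s,u): u\in U(s)\}$, costs $c_E((x,l,q),u)=c_D(x,u)$, and $p_E((x,l,q),u,(\check x,\check l,\check q))=p_D(x,u,\check x)\,p_L(\check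 x,\check l)$ if $\check q=\delta(q,l)$, and $0$ otherwise. Bars denote expected transition probabilities under $\boldsymbol\alpha$. An end component of $\overline{\mathcal P}$ is a nonempty set $T$ of states with nonempty sets of allowed actions $A(s)$, $s\in T$, closed and strongly connected under transitions of positive probability; it is accepting for $(H^i,I^i)$ if no state of $T$ has its automaton component in $H^i$ and some state has it in $I^i$. An accepting maximal end component (AMEC) is one that is maximal among those accepting for the same pair. $S_\Xi$ is the union of the AMECs, and $\overline{\mathcal P}_3$ is the sub-MDP of $\overline{\mathcal P}$ with states $S_\Xi$ and only the actions of the AMECs. **Optimization problem.** Policies are randomized and history-dependent. Let $X_r\subseteq X$ be the home states, $S_r=\{(x,l,q)\in S:x\in X_r\}$, $b_s=1$ if $s\in S_r$ and $b_s=0$ otherwise, and $\chi_r\in\mathbb R$. Put $\sigma_{s,u}=\sum_{\check s}\mathbb E_{\boldsymbol\alpha}\min(0,\,p_E(s,u,\check s)-\mathbb E_{\boldsymbol\alpha}p_E(s,u,\check s))$ and $$v^{\pi_r}_s=\mathbb E^{s,\pi_r}_{\overline{\mathcal P}_2}\sum_{t\ge0}\big(b_{s_t}+(1-b_{s_t})\sigma_{s_t,u_t}\big)\in[-\infty,1],$$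 where $\overline{\mathcal P}_2$ is $\overline{\mathcal P}$ with the transition probabilities out of $s$ multiplied by $1-b_s$. The exploration bonus at $s=(x,l,q)$ is $\xi^u_s=0$ if $\bar\alpha_U>a_U$ and $\bar\alpha_L>a_L$, and $\xi_s^u=\frac{g_U}{1+\bar\alpha_U}+\frac{g_L}{1+\bar\alpha_L}$ otherwise, where $\bar\alpha_U=\sum_{\check x\in K}\alpha^u_x(\check x)$, $\bar\alpha_L=\sum_{\check x\in K}\sum_{l'\in L(\check x)}\alpha^L_{\check x}(l')$, $K=\{\check x:\alpha^u_x(\check x)>0\}$, and $g_U,g_L,a_U,a_L>0$ are constants. The mean cost of a run for a stage cost $c$ is $\limsup_{n\to\infty}\frac1n\sum_{t<n}c(s_t,u_t)$ (the limit if it exists). Let $s_0=(x_0,l_0,q_0)\in S_\Xi$ be the current state. The suffix problem is to minimize, over pairs of an outbound policy $\pi_o$ of $\overline{\mathcal P}_3$ and a return policy $\pi_r$ of $\overline{\mathcal P}$, the expected mean of the stage cost $c_E-\xi$ in $\overline{\mathcal P}_3$ under $\pi_o$ from $s_0$, subject to $$\mathbb E^{s_0,\pi_o}_{\overline{\mathcal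 P}_3}\{v^{\pi_r}_{s_1}+\sigma_{s_0,u_0}\}\ge\chi_r.$$ The pairs may be restricted to any fixed class $\mathcal C$ (for instance all pairs, or pairs of stationary policies). A product policy induces a policy of the model by running $\mathcal A$ along the observed labels, from $q_0$ for $\pi_o$ and from $\delta(q_0,l_0)$ for $\pi_r$; denote the induced policies by $\mu_o,\mu_r$. **Lemma.** Let $(\pi_o,\pi_r)$ be an optimal solution of the suffix problem in $\mathcal C$. Then: 1. Under $\pi_o$ from $s_0$ the system remains in $S_\Xi$ at all times with probability one, in $\overline{\mathcal P}$ and in the product of almost every sample $\mathcal M$ with $\mathcal A$. 2. $\mathbb E_{\boldsymbol\alpha}\{\mathbf{Safe}^{\mu_o,\mu_r}_{\mathcal M}\}\ge\chi_r$, where $\mathbf{Safe}^{\mu_o,\mu_r}_{\mathcal M}$ is the probability that $\mathcal M$, started at $(x_0,l_0)$ with $\mu_o$ applied at the first stage and $\mu_r$ afterwards, visits $X_r$ at some stage $t\ge1$. 3. If $\xi^u_s=0$ for all $(s,u)\in E$, then $\mu_o$ minimizes the expected mean cost (stage cost $c_D$) in $\overline{\mathcal M}$ from $(x_0,l_0)$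 among the outbound policies induced by all feasible pairs of the suffix problem in $\mathcal C$. -/

import Mathlib

open MeasureTheory ProbabilityTheory Filter Topology
open scoped ENNReal

namespace SafeLTL

noncomputable section

/-! ## Markov decision processes, policies and runs -/

/-- One stage of a run: the current state and the action applied there. -/
@[ext] structure Step (S U : Type*) where
  st : S
  ac : U

instance {S U : Type*} : MeasurableSpace (Step S U) := ⊤

instance {S U : Type*} : DiscreteMeasurableSpace (Step S U) := ⟨fun _ => trivial⟩

instance {S U : Type*} [Finite S] [Finite U] : Finite (Step S U) :=
  Finite.of_injective (fun z : Step S U => (z.st, z.ac)) fun a b h => by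
    cases a; cases b; simpa using h

/-- A finite Markov decision process with state set `states`, allowed actions `act s`,
transition probabilities `p s u s'` and stage cost `cost s u`. Only the values at pairs
`s ∈ states`, `u ∈ act s` matter; `p` is a stochastic matrix at the other pairs as well. -/
structure MDP (S U : Type*) [Fintype S] where
  states : Set S
  act : S → Set U
  p : S → U → S → ℝ
  p_nonneg : ∀ s u s', 0 ≤ p s u s'
  p_sum : ∀ s u, ∑ s', p s u s' = 1
  cost : S → U → ℝ

/-- A history-dependent randomized policy: `prob h s u` is the probability of choosing `u` in the
current state `s` after the past stages `h` (in chronological order). -/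
structure Policy (S U : Type*) [Fintype U] where
  prob : List (Step S U) → S → U → ℝ
  nonneg : ∀ h s u, 0 ≤ prob h s u
  sum_one : ∀ h s, ∑ u, prob h s u = 1

section Runs

variable {S U : Type*} [Fintype S] [Fintype U]

/-- The policy chooses only actions that the MDP allows. -/
def Policy.Admissible (π : Policy S U) (P : MDP S U) : Prop :=
  ∀ h, ∀ s ∈ P.states, ∀ u, π.prob h s u ≠ 0 → u ∈ P.act s

/-- The law of the stage at state `s` after the past `h`. -/
def Policy.stageLaw (π : Policy S U) (h : List (Step S U)) (s : S) : Measure (Step S U) :=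
  ∑ u, ENNReal.ofReal (π.prob h s u) • Measure.dirac ⟨s, u⟩

instance (π : Policy S U) (h : List (Step S U)) (s : S) :
    IsProbabilityMeasure (π.stageLaw h s) := ⟨by
  simp only [Policy.stageLaw, Measure.finsetSum_apply, Measure.smul_apply, measure_univ,
    smul_eq_mul, mul_one]
  rw [← ENNReal.ofReal_sum_of_nonneg fun u _ => π.nonneg h s u, π.sum_one, ENNReal.ofReal_one]⟩

/-- The law of the stage that follows the stage `z`, where `h` is the past including `z`. -/
def MDP.nextLaw (P : MDP S U) (π : Policy S U) (h : List (Step S U)) (z : Step S U) :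
    Measure (Step S U) :=
  ∑ s', ENNReal.ofReal (P.p z.st z.ac s') • π.stageLaw h s'

instance (P : MDP S U) (π : Policy S U) (h : List (Step S U)) (z : Step S U) :
    IsProbabilityMeasure (P.nextLaw π h z) := ⟨by
  simp only [MDP.nextLaw, Measure.finsetSum_apply, Measure.smul_apply, measure_univ,
    smul_eq_mul, mul_one]
  rw [← ENNReal.ofReal_sum_of_nonneg fun s' _ => P.p_nonneg _ _ s', P.p_sum, ENNReal.ofReal_one]⟩

/-- The past stages `0, …, n` as a list. -/
def histList (n : ℕ) (a : (i : Finset.Iic n) → Step S U) : List (Step S U) :=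
  List.ofFn fun i : Fin (n + 1) => a ⟨i, Finset.mem_Iic.2 (Nat.lt_succ_iff.1 i.2)⟩

/-- The transition kernel from the stages `0, …, n` to stage `n + 1`. -/
def MDP.stepKernel (P : MDP S U) (π : Policy S U) (n : ℕ) :
    Kernel ((i : Finset.Iic n) → (fun _ : ℕ => Step S U) i) ((fun _ : ℕ => Step S U) (n + 1)) where
  toFun a := P.nextLaw π (histList n a) (a ⟨n, Finset.mem_Iic.2 le_rfl⟩)
  measurable' := .of_discrete

instance (P : MDP S U) (π : Policy S U) (n : ℕ) : IsMarkovKernel (P.stepKernel π n) :=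
  ⟨fun a => inferInstanceAs (IsProbabilityMeasure
    (P.nextLaw π (histList n a) (a ⟨n, Finset.mem_Iic.2 le_rfl⟩)))⟩

/-- The law of the infinite run of `P` from the state `s` under the policy `π`. -/
def MDP.runMeasure (P : MDP S U) (π : Policy S U) (s : S) : Measure (ℕ → Step S U) :=
  Kernel.trajMeasure (X := fun _ : ℕ => Step S U) (π.stageLaw [] s) (P.stepKernel π)

/-- The mean (long-run average) of the stage cost `c` along a run. The upper limit is taken, so
that the mean cost is defined for every run; it is the limit whenever the limit exists. -/
def runMeanCost (c : S → U → ℝ) (ω : ℕ → Step S U) : ℝ :=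
  limsup (fun n : ℕ => (∑ t ∈ Finset.range n, c (ω t).st (ω t).ac) / n) atTop

/-- The expected mean of the stage cost `c` over the runs of `P` from `s` under `π`. -/
def MDP.expMeanCost (P : MDP S U) (c : S → U → ℝ) (π : Policy S U) (s : S) : ℝ :=
  ∫ ω, runMeanCost c ω ∂(P.runMeasure π s)

/-- The probability that the run of `P` from `s` under `π` visits `G` (at some stage `t ≥ 0`). -/
def MDP.reachProb (P : MDP S U) (π : Policy S U) (s : S) (G : Set S) : ℝ :=
  (P.runMeasure π s).real {ω | ∃ t, (ω t).st ∈ G}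

/-- Expectation of `f (s_t, u_t)` from the state `s` with past `h`, `t` stages ahead, for a (possibly
substochastic) transition function `q`: the sum over all paths of length `t` of the path weight
times `f` at the end of the path. -/
def expAt (q : S → U → S → ℝ) (π : Policy S U) (f : S → U → ℝ) :
    ℕ → List (Step S U) → S → ℝ
  | 0, h, s => ∑ u, π.prob h s u * f s u
  | t + 1, h, s => ∑ u, π.prob h s u * ∑ s', q s u s' * expAt q π f t (h ++ [⟨s, u⟩]) s'

/-- Expectation of `∑_{t ≥ 0} f (s_t, u_t)` from the state `s`, as an extended real number
(the lower limit of the expected partial sums; below they always converge in `EReal`). -/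
def expTotal (q : S → U → S → ℝ) (π : Policy S U) (f : S → U → ℝ) (s : S) : EReal :=
  liminf (fun n : ℕ => ((∑ t ∈ Finset.range n, expAt q π f t [] s : ℝ) : EReal)) atTop

/-- An end component `(T, A)`: nonempty, closed under its nonempty action sets, and strongly
connected under them. -/
structure MDP.IsEndComponent (P : MDP S U) (T : Set S) (A : S → Set U) : Prop where
  nonempty : T.Nonempty
  subset : T ⊆ P.states
  act_subset : ∀ s ∈ T, A s ⊆ P.act s
  act_nonempty : ∀ s ∈ T, (A s).Nonempty
  act_off : ∀ s, s ∉ T → A s = ∅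
  closed : ∀ s ∈ T, ∀ u ∈ A s, ∀ s', 0 < P.p s u s' → s' ∈ T
  connected : ∀ s ∈ T, ∀ s' ∈ T,
    Relation.ReflTransGen (fun a b => ∃ u ∈ A a, 0 < P.p a u b) s s'

/-- An end component that is accepting for the Rabin pair `(H, I)`: it avoids `H` and meets `I`. -/
def MDP.IsAcceptingEC (P : MDP S U) (HI : Set S × Set S) (T : Set S) (A : S → Set U) : Prop :=
  P.IsEndComponent T A ∧ Disjoint T HI.1 ∧ (T ∩ HI.2).Nonempty

/-- An accepting maximal end component with respect to a set of Rabin pairs: maximal among the end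
components that are accepting for one and the same pair. -/
def MDP.IsAMEC (P : MDP S U) (Acc : Set (Set S × Set S)) (T : Set S) (A : S → Set U) : Prop :=
  ∃ HI ∈ Acc, P.IsAcceptingEC HI T A ∧
    ∀ T' A', P.IsAcceptingEC HI T' A' → T ⊆ T' → (∀ s, A s ⊆ A' s) → T' = T ∧ A' = A

/-- The union of the accepting maximal end components. -/
def MDP.amecStates (P : MDP S U) (Acc : Set (Set S × Set S)) : Set S :=
  {s | ∃ T A, P.IsAMEC Acc T A ∧ s ∈ T}

/-- The sub-MDP whose states are those of the accepting maximal end components and whose actions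
are those of these components. -/
def MDP.amecRestrict (P : MDP S U) (Acc : Set (Set S × Set S)) : MDP S U :=
  { P with
    states := P.amecStates Acc
    act := fun s => {u | ∃ T A, P.IsAMEC Acc T A ∧ s ∈ T ∧ u ∈ A s} }

end Runs

/-! ## Dirichlet distributions -/

section Dirichlet

variable {ι : Type*} [Fintype ι] [Nonempty ι]

/-- The gamma distribution with shape `a` and rate `1`, degenerate at `0` if `a = 0`. -/
def gammaShape (a : ℝ) : Measure ℝ :=
  if 0 < a then gammaMeasure a 1 else Measure.dirac 0

instance (a : ℝ) : IsProbabilityMeasure (gammaShape a) := by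
  unfold gammaShape
  split_ifs with h
  · exact isProbabilityMeasure_gammaMeasure h one_pos
  · infer_instance

open Classical in
/-- `g ↦ g / ∑ g` on nonnegative nonzero vectors (a fixed vertex of the simplex elsewhere). -/
def toSimplex (g : ι → ℝ) : stdSimplex ℝ ι :=
  if h : (∀ i, 0 ≤ g i) ∧ 0 < ∑ i, g i then
    ⟨fun i => g i / ∑ j, g j, fun i => div_nonneg (h.1 i) h.2.le, by
      rw [← Finset.sum_div, div_self h.2.ne']⟩
  else ⟨Pi.single (Classical.arbitrary ι) 1, single_mem_stdSimplex ℝ _⟩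


theorem measurable_toSimplex : Measurable (toSimplex : (ι → ℝ) → stdSimplex ℝ ι) := by
  classical
  have hsum : Measurable fun g : ι → ℝ => ∑ i, g i := by fun_prop
  have hset : MeasurableSet {g : ι → ℝ | (∀ i, 0 ≤ g i) ∧ 0 < ∑ i, g i} := by
    have h1 : MeasurableSet {g : ι → ℝ | ∀ i, 0 ≤ g i} := by measurability
    exact h1.inter (measurableSet_lt measurable_const hsum)
  refine Measurable.subtype_mk (f := fun g => (toSimplex g : ι → ℝ)) ?_
  have : (fun g : ι → ℝ => (toSimplex g : ι → ℝ)) = fun g =>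
      if (∀ i, 0 ≤ g i) ∧ 0 < ∑ i, g i then (fun i => g i / ∑ j, g j)
      else Pi.single (Classical.arbitrary ι) 1 := by
    funext g
    unfold toSimplex
    split_ifs <;> rfl
  rw [this]
  exact Measurable.ite hset (by fun_prop) measurable_const

/-- The Dirichlet distribution with parameters `α i ≥ 0` (not all zero): the law of
`(γ_i / ∑_j γ_j)_i` for independent gamma variables `γ_i` of shapes `α i` and equal rates. The
coordinates with `α i = 0` vanish almost surely. -/
def dirichlet (α : ι → ℝ) : Measure (stdSimplex ℝ ι) :=
  (Measure.pi fun i => gammaShape (α i)).map toSimplex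

instance (α : ι → ℝ) : IsProbabilityMeasure (dirichlet α) :=
  Measure.isProbabilityMeasure_map measurable_toSimplex.aemeasurable

end Dirichlet

/-! ## Probabilistically-labeled MDPs under a Dirichlet belief -/

/-- The known part of a probabilistically-labeled MDP (allowed actions, stage costs, possible
labels) together with a Dirichlet belief over its transition and labeling probabilities. -/
structure UncertainMDP (X U AP : Type*) [Fintype X] [Fintype AP] where
  act : X → Set U
  act_nonempty : ∀ x, (act x).Nonempty
  cost : X → U → ℝ
  cost_pos : ∀ x, ∀ u ∈ act x, 0 < cost x u
  /-- the sets of propositions that may hold at a state -/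
  label : X → Set (Set AP)
  /-- Dirichlet parameters of the transition distribution of a state-action pair -/
  alphaU : X → U → X → ℝ
  alphaU_nonneg : ∀ x u x', 0 ≤ alphaU x u x'
  alphaU_pos : ∀ x, ∀ u ∈ act x, 0 < ∑ x', alphaU x u x'
  /-- Dirichlet parameters of the label distribution of a state -/
  alphaL : X → Set AP → ℝ
  alphaL_nonneg : ∀ x l, 0 ≤ alphaL x l
  alphaL_off : ∀ x l, l ∉ label x → alphaL x l = 0
  alphaL_pos : ∀ x, 0 < ∑ l, alphaL x l

/-- A deterministic Rabin automaton over the alphabet `2^AP`. A pair `(H, I)` of `acc` asks that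
`H` be visited finitely often and `I` infinitely often. -/
structure DRA (AP Q : Type*) where
  step : Q → Set AP → Q
  init : Q
  acc : Set (Set Q × Set Q)

/-- The constants of the exploration bonus. -/
structure BonusParams where
  gU : ℝ
  gL : ℝ
  aU : ℝ
  aL : ℝ
  gU_pos : 0 < gU
  gL_pos : 0 < gL
  aU_pos : 0 < aU
  aL_pos : 0 < aL

section Model

variable {X U AP Q : Type*} [Fintype X] [Fintype U] [Fintype AP] [Fintype Q]

/-- The transition probabilities (of all pairs) and label probabilities of a model. -/
abbrev Params (X U AP : Type*) [Fintype X] [Fintype AP] : Type _ :=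
  (X → U → stdSimplex ℝ X) × (X → stdSimplex ℝ (Set AP))

/-- The belief: all transition and label distributions are independent and Dirichlet distributed. -/
def UncertainMDP.belief [Nonempty X] (D : UncertainMDP X U AP) : Measure (Params X U AP) :=
  (Measure.pi fun x => Measure.pi fun u => dirichlet (D.alphaU x u)).prod
    (Measure.pi fun x => dirichlet (D.alphaL x))

instance [Nonempty X] (D : UncertainMDP X U AP) : IsProbabilityMeasure D.belief := by
  unfold UncertainMDP.belief; infer_instance

/-- The sample `𝓜` of the model with parameters `θ = (p_D, p_L)`, as an MDP over the pairs of a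
robot state and its current label. -/
def UncertainMDP.sample (D : UncertainMDP X U AP) (θ : Params X U AP) : MDP (X × Set AP) U where
  states := {z | z.2 ∈ D.label z.1}
  act z := D.act z.1
  p z u z' := (θ.1 z.1 u : X → ℝ) z'.1 * (θ.2 z'.1 : Set AP → ℝ) z'.2
  p_nonneg z u z' := mul_nonneg ((θ.1 z.1 u).2.1 _) ((θ.2 z'.1).2.1 _)
  p_sum z u := by
    rw [Fintype.sum_prod_type]
    have h : ∀ x', ∑ l, (θ.2 x' : Set AP → ℝ) l = 1 := fun x' => (θ.2 x').2.2
    simp only [← Finset.mul_sum, h, mul_one]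
    exact (θ.1 z.1 u).2.2
  cost z u := D.cost z.1 u

open Classical in
/-- The product of a labeled MDP with a Rabin automaton; the automaton reads the label of the
state that is being left. -/
def MDP.prod (M : MDP (X × Set AP) U) (A : DRA AP Q) : MDP ((X × Set AP) × Q) U where
  states := {s | s.1 ∈ M.states}
  act s := M.act s.1
  p s u s' := if s'.2 = A.step s.2 s.1.2 then M.p s.1 u s'.1 else 0
  p_nonneg s u s' := by split_ifs; exacts [M.p_nonneg _ _ _, le_rfl]
  p_sum s u := by
    rw [Fintype.sum_prod_type]
    simp [M.p_sum]
  cost s u := M.cost s.1 u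

/-- The accepting pairs of the product. -/
def DRA.prodAcc (A : DRA AP Q) (X : Type*) :
    Set (Set ((X × Set AP) × Q) × Set ((X × Set AP) × Q)) :=
  {HI | ∃ hi ∈ A.acc, HI = ({s | s.2 ∈ hi.1}, {s | s.2 ∈ hi.2})}

theorem UncertainMDP.measurable_sample_p (D : UncertainMDP X U AP) (z : X × Set AP) (u : U)
    (z' : X × Set AP) : Measurable fun θ => (D.sample θ).p z u z' := by
  have h1 : Measurable fun θ : Params X U AP => ((θ.1 z.1 u : X → ℝ)) z'.1 :=
    (measurable_pi_apply z'.1).comp (measurable_subtype_coe.comp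
      ((measurable_pi_apply u).comp ((measurable_pi_apply z.1).comp measurable_fst)))
  have h2 : Measurable fun θ : Params X U AP => ((θ.2 z'.1 : Set AP → ℝ)) z'.2 :=
    (measurable_pi_apply z'.2).comp (measurable_subtype_coe.comp
      ((measurable_pi_apply z'.1).comp measurable_snd))
  exact h1.mul h2

theorem MDP.p_le_one {S V : Type*} [Fintype S] (P : MDP S V) (s : S) (u : V) (s' : S) :
    P.p s u s' ≤ 1 := by
  rw [← P.p_sum s u]
  exact Finset.single_le_sum (fun i _ => P.p_nonneg s u i) (Finset.mem_univ s')

/-- The MDP with the expected transition probabilities of a random MDP `F θ`, `θ ∼ μ`; its states,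
actions and costs are those of `P₀`. -/
def MDP.average {S Θ : Type*} [Fintype S] [MeasurableSpace Θ] (P₀ : MDP S U) (μ : Measure Θ)
    [IsProbabilityMeasure μ] (F : Θ → MDP S U)
    (hF : ∀ s u s', Measurable fun θ => (F θ).p s u s') : MDP S U where
  states := P₀.states
  act := P₀.act
  p s u s' := ∫ θ, (F θ).p s u s' ∂μ
  p_nonneg s u s' := integral_nonneg fun θ => (F θ).p_nonneg s u s'
  p_sum s u := by
    rw [← integral_finsetSum]
    · simp [MDP.p_sum]
    · intro s' _
      refine Integrable.of_bound (hF s u s').aestronglyMeasurable 1 (ae_of_all _ fun θ => ?_)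
      rw [Real.norm_of_nonneg ((F θ).p_nonneg _ _ _)]
      exact (F θ).p_le_one _ _ _
  cost := P₀.cost

theorem UncertainMDP.measurable_prod_p (D : UncertainMDP X U AP) (A : DRA AP Q)
    (s : (X × Set AP) × Q) (u : U) (s' : (X × Set AP) × Q) :
    Measurable fun θ => ((D.sample θ).prod A).p s u s' := by
  unfold MDP.prod
  dsimp only
  split_ifs
  · exact D.measurable_sample_p _ _ _
  · exact measurable_const

variable [Nonempty X]

open Classical in
/-- A parameter value, used only to read off states, actions and costs, which are common to all
samples. -/
def refParams : Params X U AP :=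
  (fun x _ => ⟨Pi.single x 1, single_mem_stdSimplex ℝ x⟩,
    fun _ => ⟨Pi.single ∅ 1, single_mem_stdSimplex ℝ ∅⟩)

/-- The model with the expected transition and label probabilities under the belief. -/
def UncertainMDP.meanModel (D : UncertainMDP X U AP) : MDP (X × Set AP) U :=
  (D.sample refParams).average D.belief D.sample D.measurable_sample_p

/-- The product with the expected transition probabilities under the belief. -/
def UncertainMDP.meanProd (D : UncertainMDP X U AP) (A : DRA AP Q) : MDP ((X × Set AP) × Q) U :=
  ((D.sample refParams).prod A).average D.belief (fun θ => (D.sample θ).prod A)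
    (D.measurable_prod_p A)

/-- The union `S_Ξ` of the accepting maximal end components of the product. -/
def UncertainMDP.amecStates (D : UncertainMDP X U AP) (A : DRA AP Q) :
    Set ((X × Set AP) × Q) :=
  (D.meanProd A).amecStates (A.prodAcc X)

/-- The sub-MDP of the expected product with the states and actions of the accepting maximal end
components only. -/
def UncertainMDP.suffixMDP (D : UncertainMDP X U AP) (A : DRA AP Q) :
    MDP ((X × Set AP) × Q) U :=
  (D.meanProd A).amecRestrict (A.prodAcc X)

open Classical in
/-- The exploration bonus. -/
def UncertainMDP.bonus (D : UncertainMDP X U AP) (b : BonusParams) (s : (X × Set AP) × Q)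
    (u : U) : ℝ :=
  let x := s.1.1
  let K : Finset X := {x' | 0 < D.alphaU x u x'}
  let totU : ℝ := ∑ x' ∈ K, D.alphaU x u x'
  let totL : ℝ := ∑ x' ∈ K, ∑ l with l ∈ D.label x', D.alphaL x' l
  if b.aU < totU ∧ b.aL < totL then 0 else b.gU / (1 + totU) + b.gL / (1 + totL)

/-- The correction term `σ`: the sum over the successors `s'` of the expectation of
`min (0, p - E p)`, where `p` is the random transition probability of the product. -/
def UncertainMDP.correction (D : UncertainMDP X U AP) (A : DRA AP Q) (s : (X × Set AP) × Q)
    (u : U) : ℝ :=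
  ∑ s', ∫ θ, min 0 (((D.sample θ).prod A).p s u s' - (D.meanProd A).p s u s') ∂D.belief

/-- The product states over the home states. -/
def homeStates (AP Q : Type*) (home : Set X) : Set ((X × Set AP) × Q) := {s | s.1.1 ∈ home}

open Classical in
/-- The value of the return policy `πr` from `s`: the expectation of
`∑_t (b (s_t) + (1 - b (s_t)) σ (s_t, u_t))` in the expected product whose transitions out of the
home states are multiplied by zero, where `b` is the indicator of the home states. -/
def UncertainMDP.returnValue (D : UncertainMDP X U AP) (A : DRA AP Q) (home : Set X)
    (πr : Policy ((X × Set AP) × Q) U) (s : (X × Set AP) × Q) : EReal :=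
  let b : (X × Set AP) × Q → ℝ := fun s => if s ∈ homeStates AP Q home then 1 else 0
  expTotal (fun s u s' => (1 - b s) * (D.meanProd A).p s u s') πr
    (fun s u => b s + (1 - b s) * D.correction A s u) s

/-- The left-hand side of the safety constraint: the expectation of `v (s_1) + σ (s_0, u_0)` in the
suffix MDP under the outbound policy. -/
def UncertainMDP.safetyBound (D : UncertainMDP X U AP) (A : DRA AP Q) (home : Set X)
    (πo πr : Policy ((X × Set AP) × Q) U) (s₀ : (X × Set AP) × Q) : EReal :=
  ∑ u, ∑ s₁, ((πo.prob [] s₀ u * (D.suffixMDP A).p s₀ u s₁ : ℝ) : EReal) *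
    (D.returnValue A home πr s₁ + (D.correction A s₀ u : EReal))

/-- Feasibility of a pair of an outbound and a return policy for the suffix problem: the outbound
policy is a policy of the suffix MDP, the return policy one of the product, and the safety
constraint holds. -/
def UncertainMDP.SuffixFeasible (D : UncertainMDP X U AP) (A : DRA AP Q) (home : Set X) (χ : ℝ)
    (s₀ : (X × Set AP) × Q)
    (π : Policy ((X × Set AP) × Q) U × Policy ((X × Set AP) × Q) U) : Prop :=
  π.1.Admissible (D.suffixMDP A) ∧ π.2.Admissible (D.meanProd A) ∧
    (χ : EReal) ≤ D.safetyBound A home π.1 π.2 s₀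

/-- The objective of the suffix problem: the expected mean of cost minus exploration bonus in the
suffix MDP. -/
def UncertainMDP.suffixObjective (D : UncertainMDP X U AP) (A : DRA AP Q) (b : BonusParams)
    (s₀ : (X × Set AP) × Q) (πo : Policy ((X × Set AP) × Q) U) : ℝ :=
  (D.suffixMDP A).expMeanCost (fun s u => (D.suffixMDP A).cost s u - D.bonus b s u) πo s₀

/-- `π` solves the suffix problem within the class `C` of pairs of policies. -/
def UncertainMDP.IsSuffixOptimal (D : UncertainMDP X U AP) (A : DRA AP Q) (b : BonusParams)
    (home : Set X) (χ : ℝ) (s₀ : (X × Set AP) × Q)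
    (C : Set (Policy ((X × Set AP) × Q) U × Policy ((X × Set AP) × Q) U))
    (π : Policy ((X × Set AP) × Q) U × Policy ((X × Set AP) × Q) U) : Prop :=
  π ∈ C ∧ D.SuffixFeasible A home χ s₀ π ∧
    ∀ π' ∈ C, D.SuffixFeasible A home χ s₀ π' →
      D.suffixObjective A b s₀ π.1 ≤ D.suffixObjective A b s₀ π'.1

end Model

/-! ## Policies of the product as policies of the model -/

section Induced

variable {X U AP Q : Type*} [Fintype U]

/-- The product stages that correspond to stages of the model, for the automaton started in `q`. -/
def DRA.lift (A : DRA AP Q) : Q → List (Step (X × Set AP) U) → List (Step ((X × Set AP) × Q) U)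
  | _, [] => []
  | q, z :: h => ⟨(z.st, q), z.ac⟩ :: A.lift (A.step q z.st.2) h

/-- The automaton state after the past `h`, started in `q`. -/
def DRA.track (A : DRA AP Q) (q : Q) (h : List (Step (X × Set AP) U)) : Q :=
  h.foldl (fun q z => A.step q z.st.2) q

/-- The policy of the model that follows the policy `π` of the product by running the automaton
from `q` along the observed labels. -/
def Policy.induced (π : Policy ((X × Set AP) × Q) U) (A : DRA AP Q) (q : Q) :
    Policy (X × Set AP) U where
  prob h z u := π.prob (A.lift q h) (z, A.track q h) u
  nonneg _ _ _ := π.nonneg _ _ _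
  sum_one _ _ := π.sum_one _ _

/-- The probability that a sample `M`, started at `z`, returns to the home states when the outbound
policy `μo` is applied at the first stage and the return policy `μr` from the next stage on. -/
def safeProb [Fintype X] [Fintype AP] (M : MDP (X × Set AP) U) (home : Set X)
    (μo μr : Policy (X × Set AP) U) (z : X × Set AP) : ℝ :=
  ∑ u, ∑ z₁, μo.prob [] z u * M.p z u z₁ * M.reachProb μr z₁ {y | y.1 ∈ home}

end Induced

end

end SafeLTL

open SafeLTL

namespace SafeLTL

noncomputable section

/-! ### Cylinders of runs -/

/-! The three claims rest on three separate observations.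

Confinement: every action kept in the suffix MDP belongs to an accepting maximal end component
through the current state, and that component is closed. Hence the union of the components is closed
under all transitions that are possible in the mean. A nonnegative transition probability with zero
expectation vanishes almost surely, so almost every sample has no further transitions and the same
argument applies to it.

Safety: let `p` be a random transition probability, `p̄` its mean and `R ∈ [0, 1]` the probability
of reaching home from the successor in the same sample. The same unknown parameters may be met again
later, so `p` and `R` can be correlated and `E (p R)` need not be `p̄ E R`. Pointwise, however, `p R
≥ p̄ R + min 0 (p - p̄)`; integrating and summing over successors loses exactly `σ`
(`sum_add_correction_le_integral`). Iterating over a finite horizon, for arbitrary pasts because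
policies depend on history, and letting the horizon grow gives `E reachProb ≥ v`. One more
application at the outbound stage gives the constraint in expectation.

Cost: the automaton is deterministic, so averaging commutes with the product, and a product run is
the image of a model run under a map that tracks the automaton (`MDP.runMeasure_prod`). With zero
bonus the objective of every feasible pair is therefore the mean cost of its induced policy, and
optimality transfers.

The run law is handled throughout by its values on cylinders, which determine it and obey a one-step
recursion (`MDP.runMeasure_real_append`). -/

/-- The first `n` stages of a run. -/
def runPrefix {α : Type*} (n : ℕ) (ω : ℕ → α) : List α := List.ofFn fun i : Fin n => ω i

/-- The runs that start with the stages `h`. -/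
def runCylinder {α : Type*} (h : List α) : Set (ℕ → α) := {ω | runPrefix h.length ω = h}

section Prefix

variable {α : Type*}

@[simp] theorem length_runPrefix (n : ℕ) (ω : ℕ → α) : (runPrefix n ω).length = n := by
  simp [runPrefix]

theorem runPrefix_zero (ω : ℕ → α) : runPrefix 0 ω = [] := by simp [runPrefix]

theorem runPrefix_succ (n : ℕ) (ω : ℕ → α) : runPrefix (n + 1) ω = runPrefix n ω ++ [ω n] := by
  rw [runPrefix, List.ofFn_succ_last]
  rfl

theorem mem_runCylinder_self (n : ℕ) (ω : ℕ → α) : ω ∈ runCylinder (runPrefix n ω) := by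
  simp [runCylinder]

theorem runCylinder_nil : runCylinder ([] : List α) = Set.univ := by
  simp [runCylinder, runPrefix]

theorem mem_runCylinder_append {h : List α} {z : α} {ω : ℕ → α} :
    ω ∈ runCylinder (h ++ [z]) ↔ ω ∈ runCylinder h ∧ ω h.length = z := by
  simp only [runCylinder, Set.mem_ofPred_eq, List.length_append, List.length_singleton,
    runPrefix_succ]
  constructor
  · intro e
    have := List.append_inj' e rfl
    exact ⟨this.1, by simpa using this.2⟩
  · rintro ⟨e1, e2⟩
    rw [e1, e2]

end Prefix

section Cylinders

variable {S U : Type*} [Fintype S] [Fintype U]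

theorem measurable_runPrefix_comp {β : Type*} [MeasurableSpace β] (n : ℕ)
    (f : List (Step S U) → β) : Measurable fun ω : ℕ → Step S U => f (runPrefix n ω) := by
  have h1 : Measurable fun ω : ℕ → Step S U => fun i : Fin n => ω i := by fun_prop
  have h2 : Measurable fun a : Fin n → Step S U => f (List.ofFn a) := .of_discrete
  exact h2.comp h1

theorem measurableSet_runCylinder (h : List (Step S U)) : MeasurableSet (runCylinder h) := by
  have := measurable_runPrefix_comp (S := S) (U := U) h.length (fun l => l = h)
  exact measurableSet_setOfPred.2 this

/-- Translates between the two encodings of a past: functions on `Finset.Iic n`, used by the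
trajectory kernels, and lists, used by policies. -/
theorem frestrictLe_preimage_singleton (n : ℕ) (a : (i : Finset.Iic n) → Step S U) :
    (Preorder.frestrictLe (π := fun _ : ℕ => Step S U) n) ⁻¹' {a} = runCylinder (histList n a) := by
  ext ω
  simp only [Set.mem_preimage, Set.mem_singleton_iff, runCylinder, Set.mem_ofPred_eq, histList,
    List.length_ofFn, runPrefix]
  rw [List.ofFn_inj]
  constructor
  · rintro rfl
    rfl
  · intro e
    funext i
    have := congrFun e ⟨i, Nat.lt_succ_iff.2 (Finset.mem_Iic.1 i.2)⟩
    simpa using this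

theorem exists_histList (h : List (Step S U)) (n : ℕ) (hn : h.length = n + 1) :
    ∃ a, histList n a = h := by
  refine ⟨fun i => h.get ⟨i, by have := Finset.mem_Iic.1 i.2; omega⟩, ?_⟩
  apply List.ext_get
  · simp [histList, hn]
  · intro i h1 h2
    simp only [histList, List.get_ofFn]
    rfl

/-- Finite measures on the space of runs are determined by the cylinders. -/
theorem measure_ext_of_runCylinder {μ ν : Measure (ℕ → Step S U)} [IsFiniteMeasure μ]
    [IsFiniteMeasure ν] (h : ∀ l, μ (runCylinder l) = ν (runCylinder l)) : μ = ν := by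
  -- With `P` the marginals of `ν`, `ν` is trivially the projective limit. Uniqueness then leaves
  -- only the marginals of `μ` to check, and initial segments suffice; there the space is finite, so
  -- singletons decide.
  let P : (I : Finset ℕ) → Measure ((i : I) → (fun _ : ℕ => Step S U) i) := fun I => ν.map I.restrict
  have hP : IsProjectiveLimit (α := fun _ : ℕ => Step S U) ν P := fun I => rfl
  refine IsProjectiveLimit.unique (α := fun _ : ℕ => Step S U) (P := P) ?_ hP
  have hfam : IsProjectiveMeasureFamily (α := fun _ : ℕ => Step S U) P := by
    intro I J hJI
    simp only [P]
    rw [Measure.map_map (by fun_prop) (by fun_prop)]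
    rfl
  rw [isProjectiveLimit_nat_iff hfam]
  intro n
  refine Measure.ext_of_singleton fun a => ?_
  have hm : Measurable (Preorder.frestrictLe (π := fun _ : ℕ => Step S U) n) := by fun_prop
  rw [Measure.map_apply hm (measurableSet_singleton _)]
  have : P (Finset.Iic n) {a} = ν (Preorder.frestrictLe (π := fun _ : ℕ => Step S U) n ⁻¹' {a}) :=
    Measure.map_apply hm (measurableSet_singleton _)
  rw [this, frestrictLe_preimage_singleton, h]

/-! ### Probabilities of single stages and of cylinders -/

theorem Policy.stageLaw_singleton (π : Policy S U) (h : List (Step S U)) (s : S) (z : Step S U) :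
    (π.stageLaw h s) {z} =
      ENNReal.ofReal (open Classical in if z.st = s then π.prob h s z.ac else 0) := by
  classical
  obtain ⟨s', u⟩ := z
  simp only [Policy.stageLaw, Measure.finsetSum_apply, Measure.smul_apply, smul_eq_mul,
    Measure.dirac_apply' _ (measurableSet_singleton _)]
  by_cases e : s' = s
  · subst e
    rw [Finset.sum_eq_single u]
    · simp
    · intro v _ hv
      simp [Set.indicator, hv]
    · simp
  · simp only [e, if_false]
    rw [Finset.sum_eq_zero]
    · simp
    · intro v _
      have : ¬ s = s' := fun h => e h.symm
      simp [Set.indicator, this]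

theorem MDP.nextLaw_singleton (P : MDP S U) (π : Policy S U) (h : List (Step S U))
    (w z : Step S U) :
    (P.nextLaw π h w) {z} = ENNReal.ofReal (P.p w.st w.ac z.st * π.prob h z.st z.ac) := by
  classical
  simp only [MDP.nextLaw, Measure.finsetSum_apply, Measure.smul_apply, smul_eq_mul,
    Policy.stageLaw_singleton]
  rw [Finset.sum_eq_single z.st]
  · simp [ENNReal.ofReal_mul (P.p_nonneg _ _ _)]
  · intro s _ hs
    simp [hs.symm]
  · simp

instance (P : MDP S U) (π : Policy S U) (s : S) : IsProbabilityMeasure (P.runMeasure π s) := by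
  unfold MDP.runMeasure
  infer_instance

/-- The distribution of the state that follows the past `h` in a run from `s`. -/
def MDP.nextState (P : MDP S U) (s : S) (h : List (Step S U)) (s' : S) : ℝ :=
  open Classical in
  match h.getLast? with
  | none => if s' = s then 1 else 0
  | some z => P.p z.st z.ac s'

theorem MDP.nextState_nil (P : MDP S U) (s s' : S) :
    P.nextState s [] s' = open Classical in if s' = s then 1 else 0 := rfl

theorem MDP.nextState_append (P : MDP S U) (s : S) (h : List (Step S U)) (z : Step S U) :
    P.nextState s (h ++ [z]) = P.p z.st z.ac := by
  funext s'
  simp [MDP.nextState]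

theorem MDP.runMeasure_map_zero (P : MDP S U) (π : Policy S U) (s : S) :
    (P.runMeasure π s).map (fun ω => ω 0) = π.stageLaw [] s := by
  have e : (fun ω : ℕ → Step S U => ω 0) =
      (fun a : (i : Finset.Iic 0) → Step S U => a ⟨0, Finset.mem_Iic.2 le_rfl⟩) ∘
        (Preorder.frestrictLe (π := fun _ : ℕ => Step S U) 0) := rfl
  rw [e, ← Measure.map_map (by fun_prop) (by fun_prop), MDP.runMeasure, Kernel.trajMeasure,
    Measure.map_comp _ _ (by fun_prop), Kernel.traj_map_frestrictLe, Kernel.partialTraj_self,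
    Measure.id_comp, Measure.map_map (by fun_prop) (by fun_prop)]
  exact Measure.map_id

theorem MDP.runMeasure_singleton (P : MDP S U) (π : Policy S U) (s : S) (z : Step S U) :
    (P.runMeasure π s) (runCylinder [z]) =
      ENNReal.ofReal (P.nextState s [] z.st * π.prob [] z.st z.ac) := by
  have e : runCylinder [z] = (fun ω : ℕ → Step S U => ω 0) ⁻¹' {z} := by
    ext ω
    simp [runCylinder, runPrefix]
  rw [e, ← Measure.map_apply (by fun_prop) (measurableSet_singleton _), P.runMeasure_map_zero,
    Policy.stageLaw_singleton, MDP.nextState_nil]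
  congr 1
  split_ifs with h
  · rw [h, one_mul]
  · rw [zero_mul]

/-- The joint law of the first stages and the next one is a composition-product with the step
kernel; evaluate it on the rectangle `{a} ×ˢ {z}`. The past is written `h ++ [w]` because the kernel
needs a last stage to move from. -/
theorem MDP.runMeasure_append (P : MDP S U) (π : Policy S U) (s : S) (h : List (Step S U))
    (w z : Step S U) :
    (P.runMeasure π s) (runCylinder (h ++ [w] ++ [z])) = (P.runMeasure π s) (runCylinder (h ++ [w])) *
      ENNReal.ofReal (P.p w.st w.ac z.st * π.prob (h ++ [w]) z.st z.ac) := by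
  set n := h.length
  obtain ⟨a, ha⟩ := exists_histList (h ++ [w]) n (by simp [n])
  have hlast : a ⟨n, Finset.mem_Iic.2 le_rfl⟩ = w := by
    have : (histList n a).getLast? = some w := by rw [ha]; simp
    rw [histList, List.ofFn_succ_last] at this
    simpa using this
  have key := Kernel.map_frestrictLe_trajMeasure_compProd_eq_map_trajMeasure
    (X := fun _ : ℕ => Step S U) (μ₀ := π.stageLaw [] s) (κ := P.stepKernel π) (a := n)
  have hms : MeasurableSet (({a} : Set ((i : Finset.Iic n) → Step S U)) ×ˢ ({z} : Set (Step S U))) :=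
    (measurableSet_singleton _).prod (measurableSet_singleton _)
  have key2 := congrArg (fun μ => μ (({a} : Set ((i : Finset.Iic n) → Step S U)) ×ˢ
    ({z} : Set (Step S U)))) key
  beta_reduce at key2
  rw [Measure.map_apply (by fun_prop) hms, Measure.compProd_apply_prod (measurableSet_singleton _)
    (measurableSet_singleton _), lintegral_singleton, Measure.map_apply (by fun_prop)
    (measurableSet_singleton _), frestrictLe_preimage_singleton, ha] at key2
  have e : (fun x : ℕ → Step S U => (Preorder.frestrictLe (π := fun _ : ℕ => Step S U) n x, x (n + 1)))
      ⁻¹' (({a} : Set ((i : Finset.Iic n) → Step S U)) ×ˢ ({z} : Set (Step S U))) =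
      runCylinder (h ++ [w] ++ [z]) := by
    ext ω
    have h1 : Preorder.frestrictLe (π := fun _ : ℕ => Step S U) n ω = a ↔ ω ∈ runCylinder (h ++ [w]) := by
      rw [← ha, ← frestrictLe_preimage_singleton]; rfl
    rw [mem_runCylinder_append, ← h1]
    simp [n]
  rw [e] at key2
  have e3 : (P.stepKernel π n) a {z} = ENNReal.ofReal (P.p w.st w.ac z.st * π.prob (h ++ [w]) z.st z.ac) := by
    rw [← P.nextLaw_singleton, ← ha, ← hlast]
    rfl
  rw [e3, mul_comm] at key2
  exact key2.symm

/-- The probabilities of the cylinders satisfy a forward recursion. -/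
theorem MDP.runMeasure_real_append (P : MDP S U) (π : Policy S U) (s : S) (h : List (Step S U))
    (z : Step S U) :
    (P.runMeasure π s).real (runCylinder (h ++ [z])) = (P.runMeasure π s).real (runCylinder h) *
      (P.nextState s h z.st * π.prob h z.st z.ac) := by
  rcases List.eq_nil_or_concat' h with rfl | ⟨h, w, rfl⟩
  · classical
    rw [List.nil_append, measureReal_def, P.runMeasure_singleton, runCylinder_nil, probReal_univ,
      one_mul, ENNReal.toReal_ofReal]
    refine mul_nonneg ?_ (π.nonneg _ _ _)
    rw [MDP.nextState_nil]
    split_ifs <;> norm_num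
  · rw [measureReal_def, P.runMeasure_append, ENNReal.toReal_mul, ENNReal.toReal_ofReal
      (mul_nonneg (P.p_nonneg _ _ _) (π.nonneg _ _ _)), P.nextState_append]
    rfl

/-- The law of the run depends only on the transition probabilities. -/
theorem MDP.runMeasure_congr {P P' : MDP S U} (h : P.p = P'.p) (π : Policy S U) (s : S) :
    P.runMeasure π s = P'.runMeasure π s := by
  refine measure_ext_of_runCylinder fun l => ?_
  rw [← ENNReal.toReal_eq_toReal_iff' (measure_ne_top _ _) (measure_ne_top _ _)]
  change (P.runMeasure π s).real _ = (P'.runMeasure π s).real _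
  induction l using List.reverseRecOn with
  | nil => simp [runCylinder_nil]
  | append_singleton l z ih =>
    rw [P.runMeasure_real_append, P'.runMeasure_real_append, ih]
    simp only [MDP.nextState, h]

/-- A set of states and actions that is closed under the transitions and the policy is almost
surely never left. -/
theorem MDP.ae_mem_of_closed (P : MDP S U) (π : Policy S U) {s : S} {T : Set S} {B : S → Set U}
    (hs : s ∈ T) (hπ : ∀ h, ∀ s ∈ T, ∀ u, π.prob h s u ≠ 0 → u ∈ B s)
    (hP : ∀ s ∈ T, ∀ u ∈ B s, ∀ s', P.p s u s' ≠ 0 → s' ∈ T) :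
    ∀ᵐ ω ∂(P.runMeasure π s), ∀ t, (ω t).st ∈ T ∧ (ω t).ac ∈ B (ω t).st := by
  -- A list whose cylinder has positive probability has all factors of the recursion nonzero, so
  -- closedness propagates along it.
  have key : ∀ l : List (Step S U), (P.runMeasure π s).real (runCylinder l) ≠ 0 →
      ∀ z ∈ l, z.st ∈ T ∧ z.ac ∈ B z.st := by
    intro l
    induction l using List.reverseRecOn with
    | nil => simp
    | append_singleton l z ih =>
      intro hne
      rw [P.runMeasure_real_append] at hne
      have h1 := left_ne_zero_of_mul hne
      have h2 := left_ne_zero_of_mul (right_ne_zero_of_mul hne)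
      have h3 := right_ne_zero_of_mul (right_ne_zero_of_mul hne)
      have hz : z.st ∈ T := by
        rcases List.eq_nil_or_concat' l with rfl | ⟨l, w, rfl⟩
        · rw [MDP.nextState_nil] at h2
          have : z.st = s := by by_contra hc; simp [hc] at h2
          rwa [this]
        · rw [P.nextState_append] at h2
          have hw := ih h1 w (by simp)
          exact hP _ hw.1 _ hw.2 _ h2
      intro y hy
      rcases List.mem_append.1 hy with hy | hy
      · exact ih h1 y hy
      · rw [List.mem_singleton] at hy
        subst hy
        exact ⟨hz, hπ _ _ hz _ h3⟩
  rw [ae_all_iff]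
  intro t
  -- There are only countably many lists, so almost surely no null cylinder contains the run.
  have hnull : ∀ᵐ ω ∂(P.runMeasure π s), ∀ l : List (Step S U),
      (P.runMeasure π s).real (runCylinder l) = 0 → ω ∉ runCylinder l := by
    rw [ae_all_iff]
    intro l
    by_cases hl : (P.runMeasure π s).real (runCylinder l) = 0
    · rw [measureReal_eq_zero_iff] at hl
      filter_upwards [measure_eq_zero_iff_ae_notMem.1 hl] with ω hω _ using hω
    · exact ae_of_all _ fun ω h0 => absurd h0 hl
  filter_upwards [hnull] with ω hω
  -- The prefix of length `t + 1` is the shortest one that contains stage `t`.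
  refine key (runPrefix (t + 1) ω) (fun h0 => hω _ h0 (mem_runCylinder_self _ _)) _ ?_
  simp [runPrefix_succ]

/-! ### Reaching a set within a finite horizon -/

open Classical in
/-- The probability of visiting `G` within `k` stages, from the state `s` with past `h`. -/
def MDP.reachWithin (P : MDP S U) (π : Policy S U) (G : Set S) : ℕ → List (Step S U) → S → ℝ
  | 0, _, _ => 0
  | k + 1, h, s => if s ∈ G then 1 else
      ∑ u, π.prob h s u * ∑ s', P.p s u s' * P.reachWithin π G k (h ++ [⟨s, u⟩]) s'

theorem sum_step {M : Type*} [AddCommMonoid M] [Fintype (Step S U)] (f : Step S U → M) :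
    ∑ z, f z = ∑ s, ∑ u, f ⟨s, u⟩ := by
  rw [← Fintype.sum_prod_type' (f := fun s u => f ⟨s, u⟩)]
  exact Fintype.sum_equiv ⟨fun z => (z.st, z.ac), fun z => ⟨z.1, z.2⟩, fun _ => rfl, fun _ => rfl⟩ _ _
    fun _ => rfl

/-- Identifies the recursion `reachWithin` with a probability under the run law. Only the empty past
is used later, but the induction passes to longer pasts. -/
theorem MDP.runMeasure_real_reach (P : MDP S U) (π : Policy S U) (s : S) (G : Set S) (k : ℕ) :
    ∀ h : List (Step S U), (P.runMeasure π s).real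
      {ω | ω ∈ runCylinder h ∧ ∃ t < k, (ω (h.length + t)).st ∈ G} =
      (P.runMeasure π s).real (runCylinder h) *
        ∑ s', P.nextState s h s' * P.reachWithin π G k h s' := by
  classical
  induction k with
  | zero => intro h; simp [MDP.reachWithin]
  | succ k ih =>
    intro h
    have : Fintype (Step S U) := Fintype.ofFinite _
    have hms : ∀ (h : List (Step S U)) (k : ℕ), MeasurableSet
        {ω : ℕ → Step S U | ω ∈ runCylinder h ∧ ∃ t < k, (ω (h.length + t)).st ∈ G} := by
      intro h k
      refine (measurableSet_runCylinder h).inter ?_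
      have : {ω : ℕ → Step S U | ∃ t < k, (ω (h.length + t)).st ∈ G} =
          ⋃ t < k, (fun ω : ℕ → Step S U => ω (h.length + t)) ⁻¹' {z | z.st ∈ G} := by
        ext; simp
      change MeasurableSet {ω : ℕ → Step S U | ∃ t < k, (ω (h.length + t)).st ∈ G}
      rw [this]
      refine .iUnion fun t => .iUnion fun _ => ?_
      exact (measurable_pi_apply _) (.of_discrete)
    -- Disjoint decomposition by the stage right after `h`: if its state lies in `G` the visit has
    -- happened, otherwise `k` stages remain.
    have hsplit : {ω : ℕ → Step S U | ω ∈ runCylinder h ∧ ∃ t < k + 1, (ω (h.length + t)).st ∈ G} =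
        ⋃ z ∈ (Finset.univ : Finset (Step S U)), (if z.st ∈ G then runCylinder (h ++ [z]) else
          {ω | ω ∈ runCylinder (h ++ [z]) ∧ ∃ t < k, (ω ((h ++ [z]).length + t)).st ∈ G}) := by
      ext ω
      simp only [Set.mem_ofPred_eq, Finset.mem_univ, Set.iUnion_true, Set.mem_iUnion]
      constructor
      · rintro ⟨hω, t, ht, hG⟩
        refine ⟨ω h.length, ?_⟩
        split_ifs with hz
        · exact mem_runCylinder_append.2 ⟨hω, rfl⟩
        · refine ⟨mem_runCylinder_append.2 ⟨hω, rfl⟩, ?_⟩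
          cases t with
          | zero => exact absurd hG hz
          | succ t =>
            refine ⟨t, by omega, ?_⟩
            have : (h ++ [ω h.length]).length + t = h.length + (t + 1) := by simp; omega
            rw [this]
            exact hG
      · rintro ⟨z, hz⟩
        split_ifs at hz with hG
        · obtain ⟨h1, h2⟩ := mem_runCylinder_append.1 hz
          exact ⟨h1, 0, by omega, by simpa [h2] using hG⟩
        · obtain ⟨h0, t, ht, h3⟩ := hz
          obtain ⟨h1, h2⟩ := mem_runCylinder_append.1 h0
          refine ⟨h1, t + 1, by omega, ?_⟩
          have : (h ++ [z]).length + t = h.length + (t + 1) := by simp; omega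
          rwa [this] at h3
    rw [hsplit, measureReal_biUnion_finset]
    · have hterm : ∀ z : Step S U, (P.runMeasure π s).real (if z.st ∈ G then runCylinder (h ++ [z]) else
          {ω | ω ∈ runCylinder (h ++ [z]) ∧ ∃ t < k, (ω ((h ++ [z]).length + t)).st ∈ G}) =
          (P.runMeasure π s).real (runCylinder h) * (P.nextState s h z.st * (π.prob h z.st z.ac *
            if z.st ∈ G then 1 else
              ∑ s', P.p z.st z.ac s' * P.reachWithin π G k (h ++ [z]) s')) := by
        intro z
        split_ifs with hz
        · rw [P.runMeasure_real_append]; ring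
        · rw [ih, P.runMeasure_real_append, P.nextState_append]; ring
      simp only [hterm]
      rw [← Finset.mul_sum, sum_step]
      congr 1
      refine Finset.sum_congr rfl fun s' _ => ?_
      dsimp only
      rw [← Finset.mul_sum, MDP.reachWithin]
      congr 1
      by_cases hG : s' ∈ G
      · simp [hG, π.sum_one]
      · simp [hG]
    · intro z _ z' _ hne
      have hsub : ∀ z : Step S U, (if z.st ∈ G then runCylinder (h ++ [z]) else
          {ω | ω ∈ runCylinder (h ++ [z]) ∧ ∃ t < k, (ω ((h ++ [z]).length + t)).st ∈ G}) ⊆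
          runCylinder (h ++ [z]) := by
        intro z
        split_ifs
        · exact le_rfl
        · exact fun ω hω => hω.1
      refine Set.disjoint_left.2 fun ω h1 h2 => hne ?_
      rw [← (mem_runCylinder_append.1 (hsub z h1)).2, ← (mem_runCylinder_append.1 (hsub z' h2)).2]
    · intro z _
      split_ifs
      · exact measurableSet_runCylinder _
      · exact hms _ _

/-- At the empty past `reachWithin` is the probability of a visit at some `t < k`; continuity from
below along these increasing events gives the limit. -/
theorem MDP.tendsto_reachWithin (P : MDP S U) (π : Policy S U) (s : S) (G : Set S) :
    Tendsto (fun k => P.reachWithin π G k [] s) atTop (𝓝 (P.reachProb π s G)) := by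
  classical
  have e : ∀ k, P.reachWithin π G k [] s =
      (P.runMeasure π s).real {ω | ∃ t < k, (ω t).st ∈ G} := by
    intro k
    have := P.runMeasure_real_reach π s G k []
    simp only [runCylinder_nil, Set.mem_univ, true_and, List.length_nil, zero_add, probReal_univ,
      one_mul, P.nextState_nil, ite_mul, zero_mul, Finset.sum_ite_eq', Finset.mem_univ,
      if_true] at this
    exact this.symm
  simp only [e, MDP.reachProb, measureReal_def]
  refine (ENNReal.tendsto_toReal (measure_ne_top _ _)).comp ?_
  have hU : {ω : ℕ → Step S U | ∃ t, (ω t).st ∈ G} = ⋃ k, {ω | ∃ t < k, (ω t).st ∈ G} := by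
    ext ω
    simp only [Set.mem_ofPred_eq, Set.mem_iUnion]
    exact ⟨fun ⟨t, ht⟩ => ⟨t + 1, t, by omega, ht⟩, fun ⟨_, t, _, ht⟩ => ⟨t, ht⟩⟩
  rw [hU]
  exact tendsto_measure_iUnion_atTop fun k l hkl ω ⟨t, ht, hG⟩ => ⟨t, ht.trans_le hkl, hG⟩

theorem MDP.reachWithin_mem_Icc (P : MDP S U) (π : Policy S U) (G : Set S) (k : ℕ) :
    ∀ h s, P.reachWithin π G k h s ∈ Set.Icc (0 : ℝ) 1 := by
  induction k with
  | zero => intro h s; simp [MDP.reachWithin]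
  | succ k ih =>
    intro h s
    rw [MDP.reachWithin]
    split_ifs
    · simp
    have hin : ∀ u, ∑ s', P.p s u s' * P.reachWithin π G k (h ++ [⟨s, u⟩]) s' ∈ Set.Icc (0 : ℝ) 1 := by
      intro u
      refine ⟨Finset.sum_nonneg fun s' _ => mul_nonneg (P.p_nonneg _ _ _) (ih _ _).1, ?_⟩
      rw [← P.p_sum s u]
      exact Finset.sum_le_sum fun s' _ => mul_le_of_le_one_right (P.p_nonneg _ _ _) (ih _ _).2
    refine ⟨Finset.sum_nonneg fun u _ => mul_nonneg (π.nonneg _ _ _) (hin u).1, ?_⟩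
    rw [← π.sum_one h s]
    exact Finset.sum_le_sum fun u _ => mul_le_of_le_one_right (π.nonneg _ _ _) (hin u).2

theorem MDP.reachProb_mem_Icc (P : MDP S U) (π : Policy S U) (s : S) (G : Set S) :
    P.reachProb π s G ∈ Set.Icc (0 : ℝ) 1 :=
  ⟨measureReal_nonneg, measureReal_le_one⟩

end Cylinders

/-! ### Runs of a labeled MDP and of its product with an automaton -/

section Lift

variable {X U AP Q : Type*}

theorem DRA.track_append (A : DRA AP Q) (q : Q) (h : List (Step (X × Set AP) U))
    (z : Step (X × Set AP) U) : A.track q (h ++ [z]) = A.step (A.track q h) z.st.2 := by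
  simp [DRA.track]

/-- `lift` recurses from the front while cylinders grow at the back; this supplies the recursion at
the back. -/
theorem DRA.lift_append (A : DRA AP Q) (h : List (Step (X × Set AP) U)) (z : Step (X × Set AP) U) :
    ∀ q, A.lift q (h ++ [z]) = A.lift q h ++ [⟨(z.st, A.track q h), z.ac⟩] := by
  induction h with
  | nil => intro q; rfl
  | cons w h ih =>
    intro q
    simp only [List.cons_append, DRA.lift, ih, DRA.track, List.foldl_cons]

/-- The model stage of a product stage. -/
def dropStep (z : Step ((X × Set AP) × Q) U) : Step (X × Set AP) U := ⟨z.st.1, z.ac⟩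

theorem DRA.map_dropStep_lift (A : DRA AP Q) (h : List (Step (X × Set AP) U)) :
    ∀ q, (A.lift q h).map dropStep = h := by
  induction h with
  | nil => intro q; rfl
  | cons w h ih => intro q; simp [DRA.lift, ih, dropStep]

/-- The product run that corresponds to a run of the model, for the automaton started in `q`. -/
def DRA.liftRun (A : DRA AP Q) (q : Q) (ω : ℕ → Step (X × Set AP) U) :
    ℕ → Step ((X × Set AP) × Q) U :=
  fun n => ⟨((ω n).st, A.track q (runPrefix n ω)), (ω n).ac⟩

theorem DRA.runPrefix_liftRun (A : DRA AP Q) (q : Q) (ω : ℕ → Step (X × Set AP) U) (n : ℕ) :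
    runPrefix n (A.liftRun q ω) = A.lift q (runPrefix n ω) := by
  induction n with
  | zero => simp [runPrefix_zero, DRA.lift]
  | succ n ih => rw [runPrefix_succ, runPrefix_succ, A.lift_append, ih]; rfl

-- Model stages determine the automaton states. Either `l` carries the tracked ones, and its
-- cylinder pulls back to that of its projection, or no lifted run starts with `l`.
open Classical in
theorem DRA.liftRun_preimage_runCylinder (A : DRA AP Q) (q : Q)
    (l : List (Step ((X × Set AP) × Q) U)) :
    A.liftRun q ⁻¹' runCylinder l =
      if A.lift q (l.map dropStep) = l then runCylinder (l.map dropStep) else ∅ := by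
  ext ω
  simp only [Set.mem_preimage, runCylinder, Set.mem_ofPred_eq, A.runPrefix_liftRun]
  constructor
  · intro e
    have e' : runPrefix l.length ω = l.map dropStep := by
      have := congrArg (List.map dropStep) e
      rwa [A.map_dropStep_lift] at this
    rw [if_pos (by rw [← e', e])]
    simpa using e'
  · split_ifs with hl
    · intro e
      simp only [Set.mem_ofPred_eq, List.length_map] at e
      rw [e, hl]
    · exact fun h => h.elim

variable [Fintype X] [Fintype U] [Fintype AP] [Fintype Q]

/-- Coordinate `n` depends only on the stages `0, …, n`, which range over a finite discrete space.
-/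
theorem DRA.measurable_liftRun (A : DRA AP Q) (q : Q) :
    Measurable (A.liftRun q : (ℕ → Step (X × Set AP) U) → ℕ → Step ((X × Set AP) × Q) U) := by
  refine measurable_pi_iff.2 fun n => ?_
  have h1 : Measurable fun ω : ℕ → Step (X × Set AP) U => fun i : Fin (n + 1) => ω i := by fun_prop
  have h2 : Measurable fun a : Fin (n + 1) → Step (X × Set AP) U =>
      (⟨((a (Fin.last n)).st, A.track q (List.ofFn fun i : Fin n => a i.castSucc)),
        (a (Fin.last n)).ac⟩ : Step ((X × Set AP) × Q) U) := .of_discrete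
  exact h2.comp h1

theorem MDP.nextState_prod (M : MDP (X × Set AP) U) (A : DRA AP Q) (z : X × Set AP) (q : Q)
    (h : List (Step (X × Set AP) U)) (s' : (X × Set AP) × Q) :
    (M.prod A).nextState (z, q) (A.lift q h) s' =
      open Classical in if s'.2 = A.track q h then M.nextState z h s'.1 else 0 := by
  rcases List.eq_nil_or_concat' h with rfl | ⟨h, w, rfl⟩
  · change (M.prod A).nextState (z, q) [] s' = _
    rw [MDP.nextState_nil, MDP.nextState_nil]
    obtain ⟨y, q'⟩ := s'
    by_cases h1 : y = z <;> by_cases h2 : q' = q <;> simp [h1, h2, DRA.track]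
  · rw [A.lift_append, MDP.nextState_append, MDP.nextState_append, A.track_append]
    rfl

/-- A product run under a policy `π` is the lift of a model run under the induced policy. -/
theorem MDP.runMeasure_prod (M : MDP (X × Set AP) U) (A : DRA AP Q)
    (π : Policy ((X × Set AP) × Q) U) (z : X × Set AP) (q : Q) :
    (M.prod A).runMeasure π (z, q) = (M.runMeasure (π.induced A q) z).map (A.liftRun q) := by
  classical
  have hprob : IsProbabilityMeasure ((M.runMeasure (π.induced A q) z).map (A.liftRun q)) :=
    Measure.isProbabilityMeasure_map (A.measurable_liftRun q).aemeasurable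
  refine measure_ext_of_runCylinder fun l => ?_
  rw [Measure.map_apply (A.measurable_liftRun q) (measurableSet_runCylinder l),
    A.liftRun_preimage_runCylinder,
    ← ENNReal.toReal_eq_toReal_iff' (measure_ne_top _ _) (measure_ne_top _ _)]
  change ((M.prod A).runMeasure π (z, q)).real _ = (M.runMeasure (π.induced A q) z).real _
  induction l using List.reverseRecOn with
  | nil => simp [DRA.lift, runCylinder_nil]
  | append_singleton l w ih =>
    rw [MDP.runMeasure_real_append, ih]
    -- Both sides vanish as soon as `l` or its extension by `w` departs from the tracked automaton
    -- states; otherwise the two one-step recursions agree factor by factor.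
    by_cases hl : A.lift q (l.map dropStep) = l
    · rw [if_pos hl]
      have e : (M.prod A).nextState (z, q) l w.st =
          if w.st.2 = A.track q (l.map dropStep) then M.nextState z (l.map dropStep) w.st.1 else 0 := by
        conv_lhs => rw [← hl]
        rw [M.nextState_prod]
      rw [e]
      simp only [List.map_append, List.map_cons, List.map_nil]
      rw [A.lift_append, hl]
      by_cases hw : w.st.2 = A.track q (l.map dropStep)
      · have hw' : (⟨((dropStep w).st, A.track q (l.map dropStep)), (dropStep w).ac⟩ :
            Step ((X × Set AP) × Q) U) = w := by
          rw [← hw]; rfl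
        rw [if_pos hw, hw', if_pos rfl, MDP.runMeasure_real_append]
        have : (π.induced A q).prob (l.map dropStep) (dropStep w).st (dropStep w).ac =
            π.prob l w.st w.ac := by
          simp only [Policy.induced, hl, ← hw]
          rfl
        rw [this]
        rfl
      · rw [if_neg hw, if_neg]
        · simp
        · intro h
          apply hw
          have := (List.append_inj' h rfl).2
          rw [List.singleton_inj] at this
          rw [← this]
    · rw [if_neg hl, if_neg]
      · simp
      · intro h
        simp only [List.map_append, List.map_cons, List.map_nil] at h
        rw [A.lift_append] at h
        exact hl (List.append_inj' h rfl).1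

theorem MDP.reachProb_prod (M : MDP (X × Set AP) U) (A : DRA AP Q)
    (π : Policy ((X × Set AP) × Q) U) (z : X × Set AP) (q : Q) (G : Set (X × Set AP)) :
    (M.prod A).reachProb π (z, q) {s | s.1 ∈ G} = M.reachProb (π.induced A q) z G := by
  have hms : MeasurableSet {ω : ℕ → Step ((X × Set AP) × Q) U | ∃ t, (ω t).st ∈ {s | s.1 ∈ G}} := by
    have : {ω : ℕ → Step ((X × Set AP) × Q) U | ∃ t, (ω t).st ∈ {s | s.1 ∈ G}} =
        ⋃ t, (fun ω => ω t) ⁻¹' {z | z.st.1 ∈ G} := by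
      ext; simp
    rw [this]
    exact .iUnion fun t => measurable_pi_apply t .of_discrete
  rw [MDP.reachProb, MDP.reachProb, M.runMeasure_prod,
    map_measureReal_apply (A.measurable_liftRun q) hms]
  rfl

theorem measurable_runMeanCost {S : Type*} [Fintype S] (c : S → U → ℝ) :
    Measurable (runMeanCost c) := by
  unfold runMeanCost
  refine Measurable.limsup fun n => ?_
  refine (Finset.measurable_fun_sum _ fun t _ => ?_).div_const _
  have : Measurable fun z : Step S U => c z.st z.ac := .of_discrete
  exact this.comp (measurable_pi_apply t)

theorem MDP.expMeanCost_prod (M : MDP (X × Set AP) U) (A : DRA AP Q)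
    (π : Policy ((X × Set AP) × Q) U) (z : X × Set AP) (q : Q) (c : X × Set AP → U → ℝ) :
    (M.prod A).expMeanCost (fun s => c s.1) π (z, q) = M.expMeanCost c (π.induced A q) z := by
  rw [MDP.expMeanCost, MDP.expMeanCost, M.runMeasure_prod,
    integral_map (A.measurable_liftRun q).aemeasurable
      (measurable_runMeanCost _).aestronglyMeasurable]
  rfl

end Lift

/-! ### Lower bounds under random transition probabilities -/

section Random

variable {S U Θ : Type*} [Fintype S] [Fintype U] [MeasurableSpace Θ] {μ : Measure Θ}
  [IsProbabilityMeasure μ] {F : Θ → MDP S U}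

theorem MDP.measurable_reachWithin (hF : ∀ s u s', Measurable fun θ => (F θ).p s u s')
    (π : Policy S U) (G : Set S) (k : ℕ) :
    ∀ h s, Measurable fun θ => (F θ).reachWithin π G k h s := by
  induction k with
  | zero => intro h s; exact measurable_const
  | succ k ih =>
    intro h s
    simp only [MDP.reachWithin]
    split_ifs
    · exact measurable_const
    · exact Finset.measurable_fun_sum _ fun u _ => (Finset.measurable_fun_sum _ fun s' _ =>
        (hF s u s').mul (ih _ _)).const_mul _

/-- A pointwise limit of `reachWithin`, which is polynomial in the transition probabilities;
measurability of the run law in `θ` is not needed. -/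
theorem MDP.measurable_reachProb (hF : ∀ s u s', Measurable fun θ => (F θ).p s u s')
    (π : Policy S U) (G : Set S) (s : S) : Measurable fun θ => (F θ).reachProb π s G :=
  measurable_of_tendsto_metrizable (fun k => MDP.measurable_reachWithin hF π G k [] s)
    (tendsto_pi_nhds.2 fun θ => (F θ).tendsto_reachWithin π s G)

theorem integrable_of_mem_Icc {f : Θ → ℝ} (hf : Measurable f) (h : ∀ θ, f θ ∈ Set.Icc (0 : ℝ) 1) :
    Integrable f μ := by
  refine Integrable.of_bound hf.aestronglyMeasurable 1 (ae_of_all _ fun θ => ?_)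
  rw [Real.norm_of_nonneg (h θ).1]
  exact (h θ).2

theorem MDP.p_mem_Icc (P : MDP S U) (s : S) (u : U) (s' : S) : P.p s u s' ∈ Set.Icc (0 : ℝ) 1 :=
  ⟨P.p_nonneg _ _ _, P.p_le_one _ _ _⟩

theorem mul_mem_Icc {a b : ℝ} (ha : a ∈ Set.Icc (0 : ℝ) 1) (hb : b ∈ Set.Icc (0 : ℝ) 1) :
    a * b ∈ Set.Icc (0 : ℝ) 1 :=
  ⟨mul_nonneg ha.1 hb.1, mul_le_one₀ ha.2 hb.1 hb.2⟩

/-- Replacing random transition probabilities by deterministic ones costs at most the expected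
negative part of the difference. -/
theorem sum_add_correction_le_integral (hF : ∀ s u s', Measurable fun θ => (F θ).p s u s')
    (P : MDP S U) (s : S) (u : U)
    {R : Θ → S → ℝ} (hR : ∀ s', Measurable fun θ => R θ s') (hR1 : ∀ θ s', R θ s' ∈ Set.Icc (0 : ℝ) 1) :
    (∑ s', P.p s u s' * ∫ θ, R θ s' ∂μ) +
        ∑ s', ∫ θ, min 0 ((F θ).p s u s' - P.p s u s') ∂μ ≤
      ∫ θ, ∑ s', (F θ).p s u s' * R θ s' ∂μ := by
  have hint : ∀ s', Integrable (fun θ => (F θ).p s u s' * R θ s') μ := fun s' =>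
    integrable_of_mem_Icc ((hF s u s').mul (hR s')) fun θ => mul_mem_Icc ((F θ).p_mem_Icc _ _ _) (hR1 θ s')
  have hRint : ∀ s', Integrable (fun θ => R θ s') μ := fun s' =>
    integrable_of_mem_Icc (hR s') fun θ => hR1 θ s'
  have hmin : ∀ s', Integrable (fun θ => min 0 ((F θ).p s u s' - P.p s u s')) μ := fun s' =>
    (integrable_const (0 : ℝ)).inf ((integrable_of_mem_Icc (hF s u s') fun θ =>
      (F θ).p_mem_Icc _ _ _).sub (integrable_const _))
  rw [integral_finsetSum _ fun s' _ => hint s', ← Finset.sum_add_distrib]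
  refine Finset.sum_le_sum fun s' _ => ?_
  rw [← integral_const_mul, ← integral_add ((hRint s').const_mul _) (hmin s')]
  refine integral_mono (((hRint s').const_mul _).add (hmin s')) (hint s') fun θ => ?_
  obtain ⟨h0, h1⟩ := hR1 θ s'
  -- If `p ≥ p̄`, then `p R ≥ p̄ R` because `R ≥ 0`. If `p ≤ p̄`, then `(p - p̄) R ≥ p - p̄` because
  -- `R ≤ 1`.
  rcases le_total 0 ((F θ).p s u s' - P.p s u s') with h | h
  · rw [min_eq_left h]; nlinarith
  · rw [min_eq_right h]; nlinarith

open Classical in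
/-- The partial sums of the expected stage rewards bound the expected probability of reaching `G`
from below. -/
theorem sum_expAt_le_integral_reachWithin (hF : ∀ s u s', Measurable fun θ => (F θ).p s u s')
    (P : MDP S U) (π : Policy S U) (G : Set S)
    {b : S → ℝ} (hb : b = fun s => if s ∈ G then 1 else 0) {σ : S → U → ℝ}
    (hσ : ∀ s u, σ s u = ∑ s', ∫ θ, min 0 ((F θ).p s u s' - P.p s u s') ∂μ) (k : ℕ) :
    ∀ h s, ∑ t ∈ Finset.range k, expAt (fun s u s' => (1 - b s) * P.p s u s') π
        (fun s u => b s + (1 - b s) * σ s u) t h s ≤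
      ∫ θ, (F θ).reachWithin π G k h s ∂μ := by
  induction k with
  | zero => intro h s; simp [MDP.reachWithin]
  | succ k ih =>
    intro h s
    rw [Finset.sum_range_succ']
    simp only [expAt, MDP.reachWithin]
    -- On `G` the factor `1 - b s = 0` kills all later terms and the reward is `1`, which is also
    -- the reach probability. Off `G` the reward is `σ`, exactly the loss of one replacement of `p`
    -- by its mean.
    by_cases hs : s ∈ G
    · simp [hb, hs, π.sum_one]
    · have hbs : b s = 0 := by simp [hb, hs]
      simp only [hs, hbs, if_false, sub_zero, one_mul, zero_add]
      have hI : ∀ u, Measurable fun θ => ∑ s', (F θ).p s u s' *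
          (F θ).reachWithin π G k (h ++ [⟨s, u⟩]) s' := fun u =>
        Finset.measurable_fun_sum _ fun s' _ =>
          (hF s u s').mul (MDP.measurable_reachWithin hF π G k _ _)
      have hint : ∀ u, Integrable (fun θ => ∑ s', (F θ).p s u s' *
          (F θ).reachWithin π G k (h ++ [⟨s, u⟩]) s') μ := fun u =>
        integrable_finsetSum _ fun s' _ => integrable_of_mem_Icc
          ((hF s u s').mul (MDP.measurable_reachWithin hF π G k _ _)) fun θ =>
            mul_mem_Icc ((F θ).p_mem_Icc _ _ _) ((F θ).reachWithin_mem_Icc _ _ _ _ _)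
      rw [integral_finsetSum _ fun u _ => (hint u).const_mul _, Finset.sum_comm,
        ← Finset.sum_add_distrib]
      refine Finset.sum_le_sum fun u _ => ?_
      rw [integral_const_mul, ← Finset.mul_sum, ← mul_add]
      refine mul_le_mul_of_nonneg_left ?_ (π.nonneg _ _ _)
      refine le_trans ?_ (sum_add_correction_le_integral hF P s u
        (fun s' => MDP.measurable_reachWithin hF π G k (h ++ [⟨s, u⟩]) s')
        (fun θ s' => (F θ).reachWithin_mem_Icc π G k _ s'))
      rw [← hσ, Finset.sum_comm]
      refine add_le_add_left (Finset.sum_le_sum fun s' _ => ?_) _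
      rw [← Finset.mul_sum]
      exact mul_le_mul_of_nonneg_left (ih _ _) (P.p_nonneg _ _ _)

-- The finite-horizon bounds pass to the limit by dominated convergence on the right. The left side
-- needs only its lower limit, which may be `⊥`.
open Classical in
theorem expTotal_le_integral_reachProb (hF : ∀ s u s', Measurable fun θ => (F θ).p s u s')
    (P : MDP S U) (π : Policy S U) (G : Set S)
    {b : S → ℝ} (hb : b = fun s => if s ∈ G then 1 else 0) {σ : S → U → ℝ}
    (hσ : ∀ s u, σ s u = ∑ s', ∫ θ, min 0 ((F θ).p s u s' - P.p s u s') ∂μ) (s : S) :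
    expTotal (fun s u s' => (1 - b s) * P.p s u s') π (fun s u => b s + (1 - b s) * σ s u) s ≤
      ((∫ θ, (F θ).reachProb π s G ∂μ : ℝ) : EReal) := by
  have hlim : Tendsto (fun k => ∫ θ, (F θ).reachWithin π G k [] s ∂μ) atTop
      (𝓝 (∫ θ, (F θ).reachProb π s G ∂μ)) := by
    refine tendsto_integral_of_dominated_convergence (fun _ => (1 : ℝ))
      (fun k => (MDP.measurable_reachWithin hF π G k [] s).aestronglyMeasurable)
      (integrable_const _) (fun k => ae_of_all _ fun θ => ?_)
      (ae_of_all _ fun θ => (F θ).tendsto_reachWithin π s G)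
    obtain ⟨h0, h1⟩ := (F θ).reachWithin_mem_Icc π G k [] s
    rwa [Real.norm_of_nonneg h0]
  rw [← ((continuous_coe_real_ereal.tendsto _).comp hlim).liminf_eq]
  exact liminf_le_liminf (Eventually.of_forall fun k => EReal.coe_le_coe_iff.2
    (sum_expAt_le_integral_reachWithin hF P π G hb hσ k [] s))

end Random

/-! ### The suffix problem -/

section Suffix

variable {X U AP Q : Type*} [Fintype X] [Fintype U] [Fintype AP] [Fintype Q] [Nonempty X]

/-- The automaton update is the same in all samples, so its indicator leaves the integral. -/
theorem UncertainMDP.meanProd_p_eq_prod (D : UncertainMDP X U AP) (A : DRA AP Q) :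
    (D.meanProd A).p = (D.meanModel.prod A).p := by
  classical
  funext s u s'
  change ∫ θ, ((D.sample θ).prod A).p s u s' ∂D.belief = _
  simp only [MDP.prod]
  split_ifs
  · rfl
  · simp

/-- Transitions that are impossible in the mean are impossible in almost every sample. -/
theorem UncertainMDP.ae_sample_p_eq_zero (D : UncertainMDP X U AP) (A : DRA AP Q) :
    ∀ᵐ θ ∂D.belief, ∀ s u s', (D.meanProd A).p s u s' = 0 → ((D.sample θ).prod A).p s u s' = 0 := by
  rw [ae_all_iff]; intro s
  rw [ae_all_iff]; intro u
  rw [ae_all_iff]; intro s'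
  by_cases h : (D.meanProd A).p s u s' = 0
  · have hint : Integrable (fun θ => ((D.sample θ).prod A).p s u s') D.belief :=
      integrable_of_mem_Icc (D.measurable_prod_p A s u s') fun θ => MDP.p_mem_Icc _ _ _ _
    have h' := (integral_eq_zero_iff_of_nonneg (fun θ => MDP.p_nonneg _ _ _ _) hint).1 h
    filter_upwards [h'] with θ hθ _ using hθ
  · exact ae_of_all _ fun θ h0 => absurd h0 h

/-- Components of different Rabin pairs may overlap, but each kept action comes with one component
that contains the state, and the successor stays in that one. -/
theorem MDP.amecRestrict_closed {S V : Type*} [Fintype S] (P : MDP S V)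
    (Acc : Set (Set S × Set S)) {s : S} {u : V} (hu : u ∈ (P.amecRestrict Acc).act s) {s' : S}
    (hp : P.p s u s' ≠ 0) : s' ∈ P.amecStates Acc := by
  obtain ⟨T, B, hT, hs, hu⟩ := hu
  have hEC : P.IsEndComponent T B := by
    obtain ⟨_, _, h, _⟩ := hT
    exact h.1
  exact ⟨T, B, hT, hEC.closed s hs u hu s' ((P.p_nonneg _ _ _).lt_of_ne hp.symm)⟩

theorem MDP.amecRestrict_subset {S V : Type*} [Fintype S] (P : MDP S V)
    (Acc : Set (Set S × Set S)) {s : S} {u : V} (hu : u ∈ (P.amecRestrict Acc).act s) :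
    s ∈ P.states ∧ u ∈ P.act s := by
  obtain ⟨T, B, ⟨_, _, h, _⟩, hs, hu⟩ := hu
  exact ⟨h.1.subset hs, h.1.act_subset s hs hu⟩

/-- Stated for any `P` supported on the mean transitions, so that it covers the mean product, the
suffix MDP and almost every sample. -/
theorem UncertainMDP.ae_mem_amecStates (D : UncertainMDP X U AP) (A : DRA AP Q)
    {s₀ : (X × Set AP) × Q} (hs₀ : s₀ ∈ D.amecStates A) {π : Policy ((X × Set AP) × Q) U}
    (hπ : π.Admissible (D.suffixMDP A)) {P : MDP ((X × Set AP) × Q) U}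
    (hP : ∀ s u s', (D.meanProd A).p s u s' = 0 → P.p s u s' = 0) :
    ∀ᵐ ω ∂(P.runMeasure π s₀), ∀ t,
      (ω t).st ∈ D.amecStates A ∧ (ω t).ac ∈ (D.suffixMDP A).act (ω t).st :=
  P.ae_mem_of_closed π hs₀ (fun h s hs u hu => hπ h s hs u hu) fun _ _ _ hu _ hp =>
    (D.meanProd A).amecRestrict_closed _ hu fun h0 => hp (hP _ _ _ h0)

/-- Without exploration bonuses the objective is the expected mean cost in the mean model under
the induced policy. -/
theorem UncertainMDP.suffixObjective_eq (D : UncertainMDP X U AP) (A : DRA AP Q) (b : BonusParams)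
    {s₀ : (X × Set AP) × Q} (hs₀ : s₀ ∈ D.amecStates A) {π : Policy ((X × Set AP) × Q) U}
    (hπ : π.Admissible (D.suffixMDP A))
    (hb : ∀ s ∈ (D.meanProd A).states, ∀ u ∈ (D.meanProd A).act s, D.bonus b s u = 0) :
    D.suffixObjective A b s₀ π =
      D.meanModel.expMeanCost D.meanModel.cost (π.induced A s₀.2) s₀.1 := by
  have hrun : (D.suffixMDP A).runMeasure π s₀ = (D.meanModel.prod A).runMeasure π s₀ :=
    MDP.runMeasure_congr (D.meanProd_p_eq_prod A) π s₀
  obtain ⟨z, q⟩ := s₀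
  rw [← D.meanModel.expMeanCost_prod A π z q D.meanModel.cost, UncertainMDP.suffixObjective,
    MDP.expMeanCost, MDP.expMeanCost, ← hrun]
  refine integral_congr_ae ?_
  -- The bonus is known to vanish only at allowed pairs, so the stage costs agree only along runs
  -- that stay in the components.
  filter_upwards [D.ae_mem_amecStates A hs₀ hπ (P := D.suffixMDP A) fun _ _ _ h => h] with ω hω
  simp only [runMeanCost]
  congr 1
  funext n
  congr 1
  refine Finset.sum_congr rfl fun t _ => ?_
  obtain ⟨h1, h2⟩ := (D.meanProd A).amecRestrict_subset _ (hω t).2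
  rw [hb _ h1 _ h2, sub_zero]
  rfl

theorem UncertainMDP.returnValue_le (D : UncertainMDP X U AP) (A : DRA AP Q) (home : Set X)
    (π : Policy ((X × Set AP) × Q) U) (s : (X × Set AP) × Q) :
    D.returnValue A home π s ≤
      ((∫ θ, ((D.sample θ).prod A).reachProb π s (homeStates AP Q home) ∂D.belief : ℝ) : EReal) := by
  classical
  exact expTotal_le_integral_reachProb (D.measurable_prod_p A) (D.meanProd A) π (homeStates AP Q home) rfl (σ := D.correction A) (fun _ _ => rfl) s

theorem safeProb_induced (M : MDP (X × Set AP) U) (A : DRA AP Q) (home : Set X)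
    (πo πr : Policy ((X × Set AP) × Q) U) (s₀ : (X × Set AP) × Q) :
    safeProb M home (πo.induced A s₀.2) (πr.induced A (A.step s₀.2 s₀.1.2)) s₀.1 =
      ∑ u, πo.prob [] s₀ u * ∑ s₁, (M.prod A).p s₀ u s₁ *
        (M.prod A).reachProb πr s₁ (homeStates AP Q home) := by
  classical
  unfold safeProb
  refine Finset.sum_congr rfl fun u _ => ?_
  conv_rhs => rw [Fintype.sum_prod_type, Finset.mul_sum]
  refine Finset.sum_congr rfl fun z₁ _ => ?_
  -- The first transition forces this automaton state, which is also where the return policy starts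
  -- tracking.
  rw [Finset.sum_eq_single (A.step s₀.2 s₀.1.2)]
  · rw [← M.reachProb_prod]
    simp only [MDP.prod, if_true, mul_assoc]
    rfl
  · intro q _ hq
    simp [MDP.prod, hq]
  · simp

theorem EReal.coe_sum_univ {ι : Type*} [Fintype ι] (f : ι → ℝ) :
    ((∑ i, f i : ℝ) : EReal) = ∑ i, (f i : EReal) :=
  map_sum (⟨⟨Real.toEReal, EReal.coe_zero⟩, EReal.coe_add⟩ : ℝ →+ EReal) f Finset.univ

theorem UncertainMDP.safetyBound_le (D : UncertainMDP X U AP) (A : DRA AP Q) (home : Set X)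
    (πo πr : Policy ((X × Set AP) × Q) U) (s₀ : (X × Set AP) × Q) :
    D.safetyBound A home πo πr s₀ ≤
      ((∫ θ, safeProb (D.sample θ) home (πo.induced A s₀.2)
        (πr.induced A (A.step s₀.2 s₀.1.2)) s₀.1 ∂D.belief : ℝ) : EReal) := by
  set R : (X × Set AP) × Q → ℝ := fun s =>
    ∫ θ, ((D.sample θ).prod A).reachProb πr s (homeStates AP Q home) ∂D.belief
  have hmeas : ∀ s, Measurable fun θ =>
      ((D.sample θ).prod A).reachProb πr s (homeStates AP Q home) :=
    MDP.measurable_reachProb (D.measurable_prod_p A) πr _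
  have h1 : D.safetyBound A home πo πr s₀ ≤
      ((∑ u, ∑ s₁, πo.prob [] s₀ u * (D.meanProd A).p s₀ u s₁ *
        (R s₁ + D.correction A s₀ u) : ℝ) : EReal) := by
    rw [UncertainMDP.safetyBound, SafeLTL.EReal.coe_sum_univ]
    refine Finset.sum_le_sum fun u _ => ?_
    rw [SafeLTL.EReal.coe_sum_univ]
    refine Finset.sum_le_sum fun s₁ _ => ?_
    rw [EReal.coe_mul (_ * _), EReal.coe_add]
    -- Bounding the return value by a real expectation moves the whole sum from `EReal` to `ℝ`, even
    -- where the value is `⊥`.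
    refine mul_le_mul_of_nonneg_left (add_le_add_left (D.returnValue_le A home πr s₁) _) ?_
    exact EReal.coe_nonneg.2 (mul_nonneg (πo.nonneg _ _ _) ((D.meanProd A).p_nonneg _ _ _))
  refine h1.trans (EReal.coe_le_coe_iff.2 ?_)
  simp only [safeProb_induced]
  have hint : ∀ u, Integrable (fun θ => ∑ s₁, ((D.sample θ).prod A).p s₀ u s₁ *
      ((D.sample θ).prod A).reachProb πr s₁ (homeStates AP Q home)) D.belief := fun u =>
    integrable_finsetSum _ fun s₁ _ => integrable_of_mem_Icc
      ((D.measurable_prod_p A s₀ u s₁).mul (hmeas s₁)) fun θ =>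
        mul_mem_Icc (MDP.p_mem_Icc _ _ _ _) (MDP.reachProb_mem_Icc _ _ _ _)
  rw [integral_finsetSum _ fun u _ => (hint u).const_mul _]
  refine Finset.sum_le_sum fun u _ => ?_
  rw [integral_const_mul]
  simp only [mul_assoc]
  rw [← Finset.mul_sum]
  refine mul_le_mul_of_nonneg_left ?_ (πo.nonneg _ _ _)
  -- The correction at `s₀` does not depend on the successor, and the mean transition probabilities
  -- sum to one, so it enters exactly once per action.
  simp only [mul_add]
  rw [Finset.sum_add_distrib, ← Finset.sum_mul, (D.meanProd A).p_sum, one_mul]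
  exact sum_add_correction_le_integral (D.measurable_prod_p A) (D.meanProd A) s₀ u hmeas fun θ s => MDP.reachProb_mem_Icc _ _ _ _

end Suffix

end

end SafeLTL

theorem lemma2 {X U AP Q : Type*} [Fintype X] [Nonempty X] [Fintype U] [Fintype AP] [Fintype Q]
    (D : UncertainMDP X U AP) (A : DRA AP Q) (home : Set X) (χ : ℝ) (b : BonusParams)
    (s₀ : (X × Set AP) × Q) (hs₀ : s₀ ∈ D.amecStates A)
    (C : Set (Policy ((X × Set AP) × Q) U × Policy ((X × Set AP) × Q) U))
    (πo πr : Policy ((X × Set AP) × Q) U)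
    (hopt : D.IsSuffixOptimal A b home χ s₀ C (πo, πr)) :
    -- the product stays inside the accepting maximal end components
    ((∀ᵐ ω ∂((D.meanProd A).runMeasure πo s₀), ∀ t, (ω t).st ∈ D.amecStates A) ∧
      ∀ᵐ θ ∂D.belief, ∀ᵐ ω ∂(((D.sample θ).prod A).runMeasure πo s₀),
        ∀ t, (ω t).st ∈ D.amecStates A) ∧
    -- the safety constraint under the belief
    χ ≤ ∫ θ, safeProb (D.sample θ) home (πo.induced A s₀.2)
      (πr.induced A (A.step s₀.2 s₀.1.2)) s₀.1 ∂D.belief ∧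
    -- minimal expected mean cost once all exploration bonuses vanish
    ((∀ s ∈ (D.meanProd A).states, ∀ u ∈ (D.meanProd A).act s, D.bonus b s u = 0) →
      ∀ π' ∈ C, D.SuffixFeasible A home χ s₀ π' →
        D.meanModel.expMeanCost D.meanModel.cost (πo.induced A s₀.2) s₀.1 ≤
          D.meanModel.expMeanCost D.meanModel.cost (π'.1.induced A s₀.2) s₀.1) := by
  obtain ⟨_, ⟨hadm, _, hsafe⟩, hmin⟩ := hopt
  refine ⟨⟨?_, ?_⟩, ?_, ?_⟩
  · filter_upwards [D.ae_mem_amecStates A hs₀ hadm (P := D.meanProd A) fun _ _ _ h => h]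
      with ω hω t using (hω t).1
  · filter_upwards [D.ae_sample_p_eq_zero A] with θ hθ
    filter_upwards [D.ae_mem_amecStates A hs₀ hadm hθ] with ω hω t using (hω t).1
  · exact EReal.coe_le_coe_iff.1 (hsafe.trans (D.safetyBound_le A home πo πr s₀))
  · intro hb π' hπ' hfeas
    rw [← D.suffixObjective_eq A b hs₀ hadm hb, ← D.suffixObjective_eq A b hs₀ hfeas.1 hb]
    exact hmin π' hπ' hfeas
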